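/- Let $H$ and $K$ be complex Hilbert spaces, and let $A, B : H \to K$ be Hilbert–Schmidt operators, that is, bounded linear operators with $\operatorname{Tr}_H A^*A = \operatorname{Tr}_K AA^* < \infty$ and $\operatorname{Tr}_H B^*B = \operatorname{Tr}_K BB^* < \infty$. Write $|A| = (A^*A)^{1/2}$ and $|A^*| = (AA^*)^{1/2}$ for the absolute values (positive square roots), which act on $H$ and on $K$ respectively, and likewise for $B$. For an operator $T$ on a Hilbert space, $\operatorname{Tr} T = \sum_i \langle e_i, T e_i\rangle$, where $(e_i)$ is an orthonormal basis. Then $A^*B$, $|A|\,|B|$ and $|A^*|\,|B^*|$ have well-defined traces (for every orthonormal basis the sum converges absolutely, to a value that does not depend on the basis), the numbers $\operatorname{Tr}_H(|A|\,|B|)$ and $\operatorname{Tr}_K(|A^*|\,|B^*|)$ are real and non-negative, and $$|\operatorname{Tr}_H A^*B| \le \bigl(\operatorname{Tr}_H |A|\,|B|\bigr)^{1/2} \cdot \bigl(\operatorname{Tr}_K |A^*|\,|B^*|\bigr)^{1/2}.$$ -/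

import Mathlib

open scoped InnerProductSpace

universe u v

namespace HilbertSchmidtTrace

/-- A bounded operator `A : H → K` is a Hilbert-Schmidt operator, i.e. `Tr A⋆A < ∞`:
for some orthonormal basis `(e i)` of `H` the sum of
`⟪e i, A⋆ A (e i)⟫ = ‖A (e i)‖ ^ 2` is finite. -/
def IsHilbertSchmidt {H : Type u} {K : Type v}
    [NormedAddCommGroup H] [InnerProductSpace ℂ H] [CompleteSpace H]
    [NormedAddCommGroup K] [InnerProductSpace ℂ K] [CompleteSpace K]
    (A : H →L[ℂ] K) : Prop :=
  ∃ (ι : Type u) (e : HilbertBasis ι ℂ H), Summable fun i => ‖A (e i)‖ ^ 2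

/-- The absolute value `|A| = (A⋆ A) ^ (1 / 2)`, the positive square root of `A⋆ A`;
it acts on the space on which `A` acts. -/
noncomputable def absOp {H : Type u} {K : Type v}
    [NormedAddCommGroup H] [InnerProductSpace ℂ H] [CompleteSpace H]
    [NormedAddCommGroup K] [InnerProductSpace ℂ K] [CompleteSpace K]
    (A : H →L[ℂ] K) : H →L[ℂ] H :=
  CFC.sqrt (A.adjoint ∘L A)

/-- The operator `T` has the trace `t`: for *every* orthonormal basis `(e i)` of `H` the sum of
the diagonal elements `⟪e i, T (e i)⟫` converges (absolutely), and its value is `t`, whatever the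
basis. -/
def HasTrace {H : Type u} [NormedAddCommGroup H] [InnerProductSpace ℂ H] [CompleteSpace H]
    (T : H →L[ℂ] H) (t : ℂ) : Prop :=
  ∀ (ι : Type u) (e : HilbertBasis ι ℂ H), HasSum (fun i => ⟪e i, T (e i)⟫_ℂ) t

theorem HasTrace.unique {H : Type u} [NormedAddCommGroup H] [InnerProductSpace ℂ H]
    [CompleteSpace H] {T : H →L[ℂ] H} {s t : ℂ} (hs : HasTrace T s) (ht : HasTrace T t) :
    s = t := by
  obtain ⟨w, e, -⟩ := exists_hilbertBasis ℂ H
  exact (hs w e).unique (ht w e)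

open Classical in
/-- The trace `Tr T` (with the value `0` for operators that have no trace). -/
noncomputable def trace {H : Type u} [NormedAddCommGroup H] [InnerProductSpace ℂ H]
    [CompleteSpace H] (T : H →L[ℂ] H) : ℂ :=
  if h : ∃ t, HasTrace T t then h.choose else 0

theorem HasTrace.trace_eq {H : Type u} [NormedAddCommGroup H] [InnerProductSpace ℂ H]
    [CompleteSpace H] {T : H →L[ℂ] H} {t : ℂ} (ht : HasTrace T t) : trace T = t := by
  have h : ∃ t, HasTrace T t := ⟨t, ht⟩
  unfold trace
  rw [dif_pos h]
  exact h.choose_spec.unique ht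

end HilbertSchmidtTrace

/-!
Suppose first that polar decompositions `A = U |A|` and `B = V |B|` are at hand, and put
`S = |A| ^ (1 / 2)`, `W = U S`, `R = |B| ^ (1 / 2)`, `Z = V R`. Then `A = W S`, `B = Z R`, and
cyclicity of the trace gives `Tr A⋆B = Tr (S W⋆ Z R) = Tr ((S R)⋆ (W⋆ Z))`, which the Cauchy-Schwarz
inequality bounds by the product of the Hilbert-Schmidt norms of `S R` and `W⋆ Z`. Since `S² = |A|`,
`R² = |B|`, `WW⋆ = |A⋆|` and `ZZ⋆ = |B⋆|`, cyclicity once more shows that the squares of these norms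
are `Tr |A| |B|` and `Tr |A⋆| |B⋆|`.

Only the factors `S` and `W` are needed, not the partial isometry `U`. They are constructed in
`exists_factorization`: as `‖A x‖ = ‖S² x‖ ≤ ‖S‖ ‖S x‖`, the map `S x ↦ A x` extends to a bounded
operator `W` that vanishes on the complement of the range of `S`, and the two identities for `W⋆W`
and `WW⋆` follow from the uniqueness of positive square roots.

The factors `S`, `R`, `W`, `Z` are in general not Hilbert-Schmidt, so the usual cyclicity of the
trace does not apply to them. Both uses of it are replaced by a computation in a basis of
eigenvectors: Hilbert-Schmidt operators are compact, hence `|A|`, `|A⋆|` and `|B|` have orthonormal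
bases of eigenvectors (`exists_eigenbasis`). The second use is `hasSum_norm_sq_comp_of_hasTrace`. For
the first, an eigenvector `e` of `|B|` is one of `R` too, and the real eigenvalue of `R` can be moved
across the inner product: `⟪e, A⋆B e⟫ = ⟪S e, W⋆ Z R e⟫ = ⟪S R e, W⋆ Z e⟫`.
-/

open Filter Topology

namespace HilbertSchmidtTrace

/-! ### Sums of squared norms over an orthonormal basis -/

section InnerProduct

variable {H : Type*} [NormedAddCommGroup H] {ι : Type*}

theorem enorm_sq_eq_ofReal (x : H) : ‖x‖ₑ ^ 2 = ENNReal.ofReal (‖x‖ ^ 2) := by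
  rw [← ofReal_norm, ENNReal.ofReal_pow (norm_nonneg _)]

/-- Passage between sums of squared norms in `ℝ` and in `[0, ∞]`. -/
theorem hasSum_norm_sq_iff (x : ι → H) {s : ℝ} (hs : 0 ≤ s) :
    HasSum (fun i => ‖x i‖ ^ 2) s ↔ ∑' i, ‖x i‖ₑ ^ 2 = ENNReal.ofReal s := by
  simp_rw [enorm_sq_eq_ofReal]
  constructor
  · intro h
    rw [← ENNReal.ofReal_tsum_of_nonneg (fun _ => by positivity) h.summable, h.tsum_eq]
  · intro h
    have h1 : Summable fun i => (ENNReal.ofReal (‖x i‖ ^ 2)).toReal :=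
      ENNReal.summable_toReal (by rw [h]; exact ENNReal.ofReal_ne_top)
    simp_rw [ENNReal.toReal_ofReal (sq_nonneg _)] at h1
    rw [← ENNReal.ofReal_tsum_of_nonneg (fun _ => by positivity) h1] at h
    rw [(ENNReal.ofReal_eq_ofReal_iff (tsum_nonneg fun _ => by positivity) hs).1 h |>.symm]
    exact h1.hasSum

variable [InnerProductSpace ℂ H]

/-- Parseval's identity. -/
theorem hasSum_norm_inner_sq (e : HilbertBasis ι ℂ H) (x : H) :
    HasSum (fun i => ‖⟪e i, x⟫_ℂ‖ ^ 2) (‖x‖ ^ 2) := by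
  have h := e.hasSum_inner_mul_inner x x
  rw [inner_self_eq_norm_sq_to_K] at h
  have h2 : ∀ i, ⟪x, e i⟫_ℂ * ⟪e i, x⟫_ℂ = ((‖⟪e i, x⟫_ℂ‖ ^ 2 : ℝ) : ℂ) := fun i => by
    rw [← inner_conj_symm x (e i), RCLike.conj_mul]; norm_cast
  simp_rw [h2] at h
  exact Complex.hasSum_ofReal.1 (by simpa using h)

theorem tsum_enorm_inner_sq (e : HilbertBasis ι ℂ H) (x : H) :
    ∑' i, ‖⟪e i, x⟫_ℂ‖ₑ ^ 2 = ‖x‖ₑ ^ 2 := by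
  have h := hasSum_norm_inner_sq e x
  simp_rw [enorm_sq_eq_ofReal]
  rw [← ENNReal.ofReal_tsum_of_nonneg (fun _ => by positivity) h.summable, h.tsum_eq]

/-- The Cauchy-Schwarz inequality for square-summable families of vectors. -/
theorem norm_sum_le_of_hasSum {x y : ι → H} {t : ℂ} {p q : ℝ}
    (ht : HasSum (fun i => ⟪x i, y i⟫_ℂ) t) (hx : HasSum (fun i => ‖x i‖ ^ 2) p)
    (hy : HasSum (fun i => ‖y i‖ ^ 2) q) : ‖t‖ ≤ √p * √q := by
  refine le_of_tendsto (show Tendsto _ atTop _ from ht.norm) (.of_forall fun s => ?_)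
  calc ‖∑ i ∈ s, ⟪x i, y i⟫_ℂ‖ ≤ ∑ i ∈ s, ‖x i‖ * ‖y i‖ :=
        (norm_sum_le _ _).trans (Finset.sum_le_sum fun i _ => norm_inner_le_norm _ _)
    _ ≤ √(∑ i ∈ s, ‖x i‖ ^ 2) * √(∑ i ∈ s, ‖y i‖ ^ 2) := Real.sum_mul_le_sqrt_mul_sqrt _ _ _
    _ ≤ √p * √q := by
      gcongr
      · exact sum_le_hasSum s (fun _ _ => by positivity) hx
      · exact sum_le_hasSum s (fun _ _ => by positivity) hy

end InnerProduct

section Operators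

variable {H K L : Type*}
    [NormedAddCommGroup H] [InnerProductSpace ℂ H] [CompleteSpace H]
    [NormedAddCommGroup K] [InnerProductSpace ℂ K] [CompleteSpace K]
    [NormedAddCommGroup L] [InnerProductSpace ℂ L] [CompleteSpace L]
    {ι κ : Type*}

theorem enorm_inner_adjoint (A : H →L[ℂ] K) (x : H) (y : K) :
    ‖⟪y, A x⟫_ℂ‖ₑ = ‖⟪x, A.adjoint y⟫_ℂ‖ₑ := by
  rw [ContinuousLinearMap.adjoint_inner_right, ← ofReal_norm, norm_inner_symm,
    ofReal_norm]

/-- `Tr A⋆A = Tr AA⋆` in `[0, ∞]`, by Parseval and exchange of the order of summation; no summability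
is needed. -/
theorem tsum_enorm_sq_adjoint (A : H →L[ℂ] K) (e : HilbertBasis ι ℂ H) (f : HilbertBasis κ ℂ K) :
    ∑' i, ‖A (e i)‖ₑ ^ 2 = ∑' k, ‖A.adjoint (f k)‖ₑ ^ 2 := by
  simp_rw [← tsum_enorm_inner_sq f (A _), ← tsum_enorm_inner_sq e (A.adjoint _)]
  rw [ENNReal.tsum_comm]
  exact tsum_congr fun k => tsum_congr fun i => by rw [enorm_inner_adjoint]

theorem tsum_enorm_sq_eq (A : H →L[ℂ] K) (e : HilbertBasis ι ℂ H) (f : HilbertBasis κ ℂ H) :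
    ∑' i, ‖A (e i)‖ₑ ^ 2 = ∑' k, ‖A (f k)‖ₑ ^ 2 := by
  obtain ⟨w, g, -⟩ := exists_hilbertBasis ℂ K
  rw [tsum_enorm_sq_adjoint A e g, tsum_enorm_sq_adjoint A f g]

theorem hasSum_norm_sq_basis {A : H →L[ℂ] K} {e : HilbertBasis ι ℂ H} {s : ℝ}
    (h : HasSum (fun i => ‖A (e i)‖ ^ 2) s) (f : HilbertBasis κ ℂ H) :
    HasSum (fun k => ‖A (f k)‖ ^ 2) s := by
  have hs : 0 ≤ s := h.nonneg fun _ => by positivity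
  rw [hasSum_norm_sq_iff _ hs] at h ⊢
  rw [← h, tsum_enorm_sq_eq A f e]

/-- The operator norm is at most the Hilbert-Schmidt norm. -/
theorem norm_sq_apply_le_of_hasSum {A : H →L[ℂ] K} {e : HilbertBasis ι ℂ H} {s : ℝ}
    (h : HasSum (fun i => ‖A (e i)‖ ^ 2) s) (x : H) : ‖A x‖ ^ 2 ≤ s * ‖x‖ ^ 2 := by
  have hs : 0 ≤ s := h.nonneg fun _ => by positivity
  obtain ⟨w, f, -⟩ := exists_hilbertBasis ℂ K
  rw [hasSum_norm_sq_iff _ hs, tsum_enorm_sq_adjoint A e f, ← hasSum_norm_sq_iff _ hs] at h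
  refine hasSum_le (fun k => ?_) (hasSum_norm_inner_sq f (A x)) (h.mul_right (‖x‖ ^ 2))
  rw [← ContinuousLinearMap.adjoint_inner_left, ← mul_pow]
  gcongr
  exact norm_inner_le_norm _ _

/-! ### Hilbert-Schmidt operators -/

theorem IsHilbertSchmidt.summable {A : H →L[ℂ] K} (hA : IsHilbertSchmidt A)
    (e : HilbertBasis ι ℂ H) : Summable fun i => ‖A (e i)‖ ^ 2 := by
  obtain ⟨κ, f, hf⟩ := hA
  exact (hasSum_norm_sq_basis hf.hasSum e).summable

theorem IsHilbertSchmidt.adjoint {A : H →L[ℂ] K} (hA : IsHilbertSchmidt A) :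
    IsHilbertSchmidt A.adjoint := by
  obtain ⟨κ, f, hf⟩ := hA
  obtain ⟨w, g, -⟩ := exists_hilbertBasis ℂ K
  have h0 : 0 ≤ ∑' i, ‖A (f i)‖ ^ 2 := tsum_nonneg fun _ => by positivity
  refine ⟨w, g, (hasSum_norm_sq_iff _ h0).2 ?_ |>.summable⟩
  rw [← tsum_enorm_sq_adjoint A f g]
  exact (hasSum_norm_sq_iff _ h0).1 hf.hasSum

theorem IsHilbertSchmidt.of_norm_eq {A : H →L[ℂ] K} (hA : IsHilbertSchmidt A) {B : H →L[ℂ] L}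
    (h : ∀ x, ‖B x‖ = ‖A x‖) : IsHilbertSchmidt B := by
  obtain ⟨κ, f, hf⟩ := hA
  exact ⟨κ, f, by simpa only [h] using hf⟩

theorem IsHilbertSchmidt.add_smul {A B : H →L[ℂ] K} (hA : IsHilbertSchmidt A)
    (hB : IsHilbertSchmidt B) (c : ℂ) : IsHilbertSchmidt (A + c • B) := by
  obtain ⟨κ, f, hf⟩ := hA
  refine ⟨κ, f, Summable.of_nonneg_of_le (fun _ => by positivity) (fun i => ?_)
    ((hf.mul_left 2).add ((hB.summable f).mul_left (2 * ‖c‖ ^ 2)))⟩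
  have h1 : ‖(A + c • B) (f i)‖ ≤ ‖A (f i)‖ + ‖c‖ * ‖B (f i)‖ := by
    simpa [norm_smul] using norm_add_le (A (f i)) (c • B (f i))
  calc _ ≤ (‖A (f i)‖ + ‖c‖ * ‖B (f i)‖) ^ 2 := by gcongr
    _ ≤ _ := by nlinarith [sq_nonneg (‖A (f i)‖ - ‖c‖ * ‖B (f i)‖)]

/-- The product `A⋆B` of Hilbert-Schmidt operators has a trace. Polarization writes its diagonal
elements as combinations of the `‖(A + c B) (e i)‖ ^ 2`, whose sums do not depend on the basis. -/
theorem IsHilbertSchmidt.exists_hasTrace {H : Type u} [NormedAddCommGroup H]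
    [InnerProductSpace ℂ H] [CompleteSpace H] {A B : H →L[ℂ] K} (hA : IsHilbertSchmidt A)
    (hB : IsHilbertSchmidt B) : ∃ t, HasTrace (A.adjoint ∘L B) t := by
  obtain ⟨w, g, -⟩ := exists_hilbertBasis ℂ H
  have key (c : ℂ) : ∃ s : ℝ, ∀ (ι : Type u) (e : HilbertBasis ι ℂ H),
      HasSum (fun i => ((‖A (e i) + c • B (e i)‖ : ℝ) : ℂ) ^ 2) s := by
    refine ⟨∑' i, ‖(A + c • B) (g i)‖ ^ 2, fun ι e => ?_⟩
    exact_mod_cast hasSum_norm_sq_basis ((hA.add_smul hB c).summable g).hasSum e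
  obtain ⟨s₁, h₁⟩ := key 1
  obtain ⟨s₂, h₂⟩ := key (-1)
  obtain ⟨s₃, h₃⟩ := key (-Complex.I)
  obtain ⟨s₄, h₄⟩ := key Complex.I
  refine ⟨(s₁ - s₂ + (s₃ - s₄) * Complex.I) / 4, fun ι e => ?_⟩
  have h := ((((h₁ ι e).sub (h₂ ι e)).add
    (((h₃ ι e).sub (h₄ ι e)).mul_right Complex.I)).div_const 4)
  convert! h using 1
  funext i
  rw [ContinuousLinearMap.comp_apply, ContinuousLinearMap.adjoint_inner_right,
    inner_eq_sum_norm_sq_div_four]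
  simp [sub_eq_add_neg]

theorem isCompactOperator_smulRight {H K : Type*} [NormedAddCommGroup H] [NormedSpace ℂ H]
    [NormedAddCommGroup K] [NormedSpace ℂ K] (φ : H →L[ℂ] ℂ) (y : K) :
    IsCompactOperator (φ.smulRight y) := by
  have h : IsCompactOperator (φ : H → ℂ) :=
    ((isCompactOperator_id_iff_finiteDimensional (𝕜 := ℂ) (E := ℂ)).2 inferInstance).comp_clm φ
  exact h.clm_comp (ContinuousLinearMap.toSpanSingleton ℂ y)

theorem IsHilbertSchmidt.isCompactOperator {A : H →L[ℂ] K} (hA : IsHilbertSchmidt A) :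
    IsCompactOperator A := by
  classical
  obtain ⟨κ, e, he⟩ := hA
  -- `F s` is `A` composed with the orthogonal projection onto the span of the `e i`, `i ∈ s`; it
  -- converges to `A` because the square of the norm of `A - F s` is at most a tail of a convergent sum.
  let F (s : Finset κ) : H →L[ℂ] K := ∑ i ∈ s, (innerSL ℂ (e i)).smulRight (A (e i))
  have hF (s : Finset κ) : IsCompactOperator (F s) :=
    (compactOperator (RingHom.id ℂ) H K).sum_mem fun i _ => isCompactOperator_smulRight _ _
  set S := ∑' i, ‖A (e i)‖ ^ 2 with hS
  have hFe (s : Finset κ) (i : κ) : (A - F s) (e i) = if i ∈ s then 0 else A (e i) := by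
    have : F s (e i) = if i ∈ s then A (e i) else 0 := by
      simp [F, orthonormal_iff_ite.1 e.orthonormal]
    rw [sub_apply, this]
    split_ifs <;> simp
  have hsum (s : Finset κ) :
      HasSum (fun i => ‖(A - F s) (e i)‖ ^ 2) (S - ∑ i ∈ s, ‖A (e i)‖ ^ 2) := by
    have h1 : HasSum (fun i => if i ∈ s then ‖A (e i)‖ ^ 2 else 0) (∑ i ∈ s, ‖A (e i)‖ ^ 2) := by
      rw [← Finset.sum_congr rfl fun i hi => if_pos hi]
      exact hasSum_sum_of_ne_finset_zero fun i hi => if_neg hi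
    convert! he.hasSum.sub h1 using 1
    funext i
    rw [hFe]
    split_ifs <;> simp
  have hb (s : Finset κ) : ‖F s - A‖ ≤ √(S - ∑ i ∈ s, ‖A (e i)‖ ^ 2) := by
    rw [norm_sub_rev]
    refine ContinuousLinearMap.opNorm_le_bound _ (Real.sqrt_nonneg _) fun x => ?_
    refine le_of_sq_le_sq ?_ (by positivity)
    rw [mul_pow, Real.sq_sqrt ((hsum s).nonneg fun _ => by positivity)]
    exact norm_sq_apply_le_of_hasSum (hsum s) x
  have hlim : Tendsto (fun s : Finset κ => √(S - ∑ i ∈ s, ‖A (e i)‖ ^ 2)) atTop (𝓝 0) := by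
    have h := ((tendsto_const_nhds (x := S)).sub (show Tendsto _ atTop _ from he.hasSum)).sqrt
    simpa only [← hS, sub_self, Real.sqrt_zero] using h
  exact isCompactOperator_of_tendsto
    (tendsto_iff_norm_sub_tendsto_zero.2 (squeeze_zero (fun _ => norm_nonneg _) hb hlim))
    (.of_forall hF)

/-! ### Positive operators and absolute values -/

theorem adjoint_eq_of_nonneg {T : H →L[ℂ] H} (hT : 0 ≤ T) : T.adjoint = T :=
  ((ContinuousLinearMap.nonneg_iff_isPositive T).1 hT).isSelfAdjoint

/-- An eigenvector of `S²`, with eigenvalue `a²`, is an eigenvector of the positive operator `S`, with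
eigenvalue `a`. -/
theorem apply_eq_smul_of_sq_apply {S : H →L[ℂ] H} (hS : 0 ≤ S) {a : ℝ} (ha : 0 ≤ a) {x : H}
    (h : S (S x) = ((a ^ 2 : ℝ) : ℂ) • x) : S x = (a : ℂ) • x := by
  rcases ha.eq_or_lt with rfl | ha
  · have h1 : ⟪S x, S x⟫_ℂ = 0 := by
      rw [← ContinuousLinearMap.adjoint_inner_right, adjoint_eq_of_nonneg hS, h]; simp
    simpa using h1
  -- `S x - a x` would be an eigenvector of `S` for the negative eigenvalue `-a`.
  · have h1 : S (S x - (a : ℂ) • x) = (-a : ℂ) • (S x - (a : ℂ) • x) := by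
      rw [map_sub, map_smul, h, smul_sub, smul_smul]
      push_cast
      module
    have h2 := ((ContinuousLinearMap.nonneg_iff_isPositive S).1 hS).inner_nonneg_right
      (S x - (a : ℂ) • x)
    rw [h1, inner_smul_right, inner_self_eq_norm_sq_to_K] at h2
    have h3 : 0 ≤ -a * ‖S x - (a : ℂ) • x‖ ^ 2 :=
      Complex.zero_le_real.1 (by simpa using h2)
    have h4 : ‖S x - (a : ℂ) • x‖ ^ 2 = 0 := by nlinarith [sq_nonneg ‖S x - (a : ℂ) • x‖]
    exact sub_eq_zero.1 (norm_eq_zero.1 (pow_eq_zero_iff two_ne_zero |>.1 h4))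

/-- A compact positive operator has an orthonormal basis of eigenvectors. The index type is in the
universe of `H`, so that the basis may be used to evaluate traces. -/
theorem exists_eigenbasis {H : Type u} [NormedAddCommGroup H] [InnerProductSpace ℂ H]
    [CompleteSpace H] {T : H →L[ℂ] H} (hT : IsCompactOperator T) (hs : 0 ≤ T) :
    ∃ (ι : Type u) (e : HilbertBasis ι ℂ H) (a : ι → ℝ), (∀ i, 0 ≤ a i) ∧
      ∀ i, T (e i) = (a i : ℂ) • e i := by
  have hpos := (ContinuousLinearMap.nonneg_iff_isPositive T).1 hs
  have hsymm : (T : H →ₗ[ℂ] H).IsSymmetric := hpos.isSymmetric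
  let E (μ : ℂ) : Submodule ℂ H := Module.End.eigenspace (T : Module.End ℂ H) μ
  have (μ : ℂ) : CompleteSpace (E μ) := by
    have : IsClosed (E μ : Set H) := by
      have : (E μ : Set H) = {x | T x = μ • x} := by
        ext x; simp [E]
      rw [this]
      exact isClosed_eq T.continuous (continuous_const_smul μ)
    exact this.completeSpace_coe
  choose w b hb using fun μ => exists_hilbertBasis ℂ (E μ)
  have hon : Orthonormal ℂ fun p : Σ μ, w μ => ((b p.1 p.2 : E p.1) : H) :=
    hsymm.orthogonalFamily_eigenspaces.orthonormal_sigma_orthonormal fun μ => (b μ).orthonormal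
  have hspan : (Submodule.span ℂ (Set.range fun p : Σ μ, w μ => ((b p.1 p.2 : E p.1) : H)))ᗮ = ⊥ := by
    rw [eq_bot_iff, ← T.orthogonalComplement_iSup_eigenspaces_eq_bot hT hsymm]
    intro x hx
    rw [Submodule.mem_orthogonal] at hx 
    rw [← Submodule.iInf_orthogonal, Submodule.mem_iInf]
    intro μ
    have h0 : (fun i => ⟪((b μ i : E μ) : H), x⟫_ℂ • b μ i) = fun _ => 0 := by
      funext i
      rw [hx _ (Submodule.subset_span ⟨⟨μ, i⟩, rfl⟩), zero_smul]
    have h1 := (b μ).hasSum_orthogonalProjectionOnto x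
    rw [h0] at h1
    exact Submodule.orthogonalProjectionOnto_eq_zero_iff.1 (h1.unique hasSum_zero)
  have hev (p : Σ μ, w μ) : T ((b p.1 p.2 : E p.1) : H) = p.1 • ((b p.1 p.2 : E p.1) : H) :=
    Module.End.mem_eigenspace_iff.1 (b p.1 p.2).2
  refine ⟨Σ μ, w μ, HilbertBasis.mkOfOrthogonalEqBot hon hspan, fun p => ‖T (b p.1 p.2 : H)‖,
    fun p => norm_nonneg _, fun p => ?_⟩
  rw [HilbertBasis.coe_mkOfOrthogonalEqBot]
  have h1 := hpos.inner_nonneg_right ((b p.1 p.2 : E p.1) : H)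
  have h2 : ‖((b p.1 p.2 : E p.1) : H)‖ = 1 := hon.1 p
  rw [hev, inner_smul_right, inner_self_eq_norm_sq_to_K, h2] at h1
  simp only [hev, norm_smul, h2, mul_one]
  congr 1
  exact Complex.eq_coe_norm_of_nonneg (by simpa using h1)

theorem absOp_nonneg (A : H →L[ℂ] K) : 0 ≤ absOp A := CFC.sqrt_nonneg _

theorem absOp_mul_absOp (A : H →L[ℂ] K) : absOp A * absOp A = A.adjoint ∘L A :=
  CFC.sqrt_mul_sqrt_self _
    ((ContinuousLinearMap.nonneg_iff_isPositive _).2 (ContinuousLinearMap.isPositive_adjoint_comp_self A))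

theorem norm_absOp_apply (A : H →L[ℂ] K) (x : H) : ‖absOp A x‖ = ‖A x‖ := by
  have h : ⟪x, absOp A (absOp A x)⟫_ℂ = ⟪x, A.adjoint (A x)⟫_ℂ :=
    congrArg (fun T : H →L[ℂ] H => ⟪x, T x⟫_ℂ) (absOp_mul_absOp A)
  rw [← ContinuousLinearMap.adjoint_inner_left, adjoint_eq_of_nonneg (absOp_nonneg A),
    ContinuousLinearMap.adjoint_inner_right, inner_self_eq_norm_sq_to_K,
    inner_self_eq_norm_sq_to_K] at h
  exact (pow_left_inj₀ (norm_nonneg _) (norm_nonneg _) two_ne_zero).1 (by exact_mod_cast h)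

theorem IsHilbertSchmidt.absOp {A : H →L[ℂ] K} (hA : IsHilbertSchmidt A) :
    IsHilbertSchmidt (absOp A) := hA.of_norm_eq (norm_absOp_apply A)

/-! ### Factorization of an operator through the square root of its absolute value -/

/-- Douglas's factorization: if `‖A x‖ ≤ C ‖S x‖` for all `x`, then `A = W S` for a bounded `W` that
vanishes on the orthogonal complement of the range of `S`. -/
theorem exists_comp_eq_of_norm_le {A : H →L[ℂ] K} {S : H →L[ℂ] L} {C : ℝ}
    (h : ∀ x, ‖A x‖ ≤ C * ‖S x‖) :
    ∃ W : L →L[ℂ] K, (∀ x, W (S x) = A x) ∧ ∀ y, S.adjoint y = 0 → W y = 0 := by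
  let M : Submodule ℂ L := (LinearMap.range (S : H →ₗ[ℂ] L)).topologicalClosure
  have : CompleteSpace M := (Submodule.isClosed_topologicalClosure _).completeSpace_coe
  have hM (x : H) : S x ∈ M := Submodule.le_topologicalClosure _ ⟨x, rfl⟩
  let e : H →ₗ[ℂ] M := (S : H →ₗ[ℂ] L).codRestrict M hM
  have he : DenseRange e := by
    intro y
    rw [closure_subtype]
    refine closure_mono ?_ y.2
    rintro _ ⟨x, rfl⟩
    exact ⟨e x, ⟨x, rfl⟩, rfl⟩
  refine ⟨((A : H →ₗ[ℂ] K).extendOfNorm e) ∘L M.orthogonalProjectionOnto, fun x => ?_, fun y hy => ?_⟩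
  · have h1 : M.orthogonalProjectionOnto (S x) = e x :=
      Submodule.orthogonalProjectionOnto_mem_subspace_eq_self (e x)
    rw [ContinuousLinearMap.comp_apply, h1, LinearMap.extendOfNorm_eq he ⟨C, h⟩]
    rfl
  · have h1 : y ∈ Mᗮ := by
      rw [Submodule.orthogonal_closure]
      rintro _ ⟨x, rfl⟩
      change ⟪S x, y⟫_ℂ = 0
      rw [← ContinuousLinearMap.adjoint_inner_right, hy, inner_zero_right]
    rw [ContinuousLinearMap.comp_apply,
      Submodule.orthogonalProjectionOnto_eq_zero_iff.2 h1, map_zero]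

/-- A self-adjoint `T` that vanishes on `ker S` is zero as soon as `S T S` is. -/
theorem eq_zero_of_conj_eq_zero {S T : H →L[ℂ] H} (hS : 0 ≤ S) (hT : T.adjoint = T)
    (h : ∀ x, S (T (S x)) = 0) (hker : ∀ x, S x = 0 → T x = 0) : T = 0 := by
  -- `T² x = 0` implies `T x = 0`.
  have hTT (x : H) (hx : S (T x) = 0) : T x = 0 := by
    rw [← inner_self_eq_zero (𝕜 := ℂ), ← ContinuousLinearMap.adjoint_inner_right, hT, hker _ hx,
      inner_zero_right]
  have hTS (x : H) : T (S x) = 0 := hTT _ (h x)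
  ext x
  refine hTT x (ext_inner_left ℂ fun y => ?_)
  rw [← ContinuousLinearMap.adjoint_inner_left, adjoint_eq_of_nonneg hS,
    ← ContinuousLinearMap.adjoint_inner_left, hT, hTS, inner_zero_left, inner_zero_right]

/-- The substitute for the polar decomposition: `A = W S`, where `S` is the square root of `|A|`, and `W`
satisfies `W⋆W = |A|` and `WW⋆ = |A⋆|`. In terms of the polar decomposition `A = U |A|`, the operator
`W` is `U |A| ^ (1 / 2)`. -/
theorem exists_factorization (A : H →L[ℂ] K) :
    ∃ (S : H →L[ℂ] H) (W : H →L[ℂ] K), 0 ≤ S ∧ S * S = absOp A ∧ W ∘L S = A ∧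
      W.adjoint ∘L W = absOp A ∧ W ∘L W.adjoint = absOp A.adjoint := by
  set S : H →L[ℂ] H := CFC.sqrt (absOp A) with hS
  have hS0 : 0 ≤ S := CFC.sqrt_nonneg _
  have hSS : S * S = absOp A := CFC.sqrt_mul_sqrt_self _ (absOp_nonneg A)
  have hSa := adjoint_eq_of_nonneg hS0
  obtain ⟨W, hW, hW0⟩ := exists_comp_eq_of_norm_le (A := A) (S := S) (C := ‖S‖) fun x => by
    rw [← norm_absOp_apply, ← hSS]
    exact S.le_opNorm (S x)
  have hWS : W ∘L S = A := by ext x; exact hW x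
  have hWW : W.adjoint ∘L W = absOp A := by
    rw [← sub_eq_zero]
    refine eq_zero_of_conj_eq_zero hS0 ?_ (fun x => ?_) fun x hx => ?_
    · rw [map_sub, ContinuousLinearMap.adjoint_comp, ContinuousLinearMap.adjoint_adjoint,
        adjoint_eq_of_nonneg (absOp_nonneg A)]
    · have h1 : S ∘L (W.adjoint ∘L W) ∘L S = A.adjoint ∘L A := by
        rw [← hWS, ContinuousLinearMap.adjoint_comp, hSa]; rfl
      have h2 : S ∘L absOp A ∘L S = A.adjoint ∘L A := by
        rw [← absOp_mul_absOp, ← hSS]; rfl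
      have h3 := congrArg (fun T : H →L[ℂ] H => T x) (h1.trans h2.symm)
      rw [sub_apply, map_sub]
      exact sub_eq_zero.2 h3
    · rw [sub_apply, ← hSS, ContinuousLinearMap.comp_apply, hW0 x (by rw [hSa, hx])]
      simp [hx]
  refine ⟨S, W, hS0, hSS, hWS, hWW, (CFC.sqrt_unique ?_ ?_).symm⟩
  · calc (W ∘L W.adjoint) * (W ∘L W.adjoint) = W ∘L (W.adjoint ∘L W) ∘L W.adjoint := rfl
      _ = (W ∘L S) ∘L (W ∘L S).adjoint := by
        rw [hWW, ← hSS, ContinuousLinearMap.adjoint_comp, hSa]; rfl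
      _ = A.adjoint.adjoint ∘L A.adjoint := by rw [hWS, ContinuousLinearMap.adjoint_adjoint]
  · exact (ContinuousLinearMap.nonneg_iff_isPositive _).2
      (ContinuousLinearMap.isPositive_self_comp_adjoint W)

end Operators

/-! ### Traces of products as Hilbert-Schmidt norms -/

/-- If `P = X⋆X` is Hilbert-Schmidt and `Q = YY⋆`, then `Tr PQ` is the square of the Hilbert-Schmidt norm
of `X Y`. This is an instance of the cyclicity of the trace in which `X` and `Y` need not be
Hilbert-Schmidt themselves. In an orthonormal basis of eigenvectors of `P` both sides are sums of
non-negative terms, which can be rearranged. -/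
theorem hasSum_norm_sq_comp_of_hasTrace {G : Type*} {K : Type v} {L : Type*}
    [NormedAddCommGroup G] [InnerProductSpace ℂ G] [CompleteSpace G]
    [NormedAddCommGroup K] [InnerProductSpace ℂ K] [CompleteSpace K]
    [NormedAddCommGroup L] [InnerProductSpace ℂ L] [CompleteSpace L]
    {ι : Type*} {P Q : K →L[ℂ] K} (hP : IsHilbertSchmidt P) (X : K →L[ℂ] L) (Y : G →L[ℂ] K)
    (hX : X.adjoint ∘L X = P) (hY : Y ∘L Y.adjoint = Q) {t : ℂ} (ht : HasTrace (P ∘L Q) t)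
    (g : HilbertBasis ι ℂ G) : t.im = 0 ∧ HasSum (fun i => ‖X (Y (g i))‖ ^ 2) t.re := by
  have hP0 : 0 ≤ P := by
    rw [← hX]
    exact (ContinuousLinearMap.nonneg_iff_isPositive _).2
      (ContinuousLinearMap.isPositive_adjoint_comp_self X)
  have hPa := adjoint_eq_of_nonneg hP0
  obtain ⟨κ, e, a, ha, he⟩ := exists_eigenbasis hP.isCompactOperator hP0
  have htr : HasSum (fun k => ((a k * ‖Y.adjoint (e k)‖ ^ 2 : ℝ) : ℂ)) t := by
    convert! ht κ e using 1
    funext k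
    symm
    rw [ContinuousLinearMap.comp_apply, ← ContinuousLinearMap.adjoint_inner_left, hPa, he, ← hY,
      inner_smul_left, ContinuousLinearMap.comp_apply, ← ContinuousLinearMap.adjoint_inner_left,
      inner_self_eq_norm_sq_to_K]
    simp
  have hre : HasSum (fun k => a k * ‖Y.adjoint (e k)‖ ^ 2) t.re := Complex.hasSum_re htr
  have him : HasSum (fun k : κ => (0 : ℝ)) t.im := by
    simpa only [Complex.ofReal_im] using Complex.hasSum_im htr
  refine ⟨him.unique hasSum_zero, ?_⟩
  have hdiag (y : K) : ‖X y‖ₑ ^ 2 = ∑' k, ENNReal.ofReal (a k) * ‖⟪e k, y⟫_ℂ‖ₑ ^ 2 := by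
    have h1 := e.hasSum_inner_mul_inner y (P y)
    have h2 : HasSum (fun k => a k * ‖⟪e k, y⟫_ℂ‖ ^ 2) (‖X y‖ ^ 2) := by
      rw [← Complex.hasSum_ofReal]
      convert! h1 using 1
      · funext k
        rw [← ContinuousLinearMap.adjoint_inner_left P, hPa, he, inner_smul_left,
          ← inner_conj_symm y (e k), mul_left_comm, RCLike.conj_mul]
        simp
      · rw [← hX, ContinuousLinearMap.comp_apply, ContinuousLinearMap.adjoint_inner_right,
          inner_self_eq_norm_sq_to_K]
        simp
    simp_rw [enorm_sq_eq_ofReal, ← ENNReal.ofReal_mul (ha _)]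
    rw [← ENNReal.ofReal_tsum_of_nonneg (fun k => mul_nonneg (ha k) (by positivity)) h2.summable,
      h2.tsum_eq]
  have ht0 : 0 ≤ t.re := hre.nonneg fun k => mul_nonneg (ha k) (by positivity)
  rw [hasSum_norm_sq_iff _ ht0]
  simp_rw [hdiag]
  rw [ENNReal.tsum_comm]
  simp_rw [ENNReal.tsum_mul_left, fun k i => enorm_inner_adjoint Y (g i) (e k),
    tsum_enorm_inner_sq g, enorm_sq_eq_ofReal, ← ENNReal.ofReal_mul (ha _)]
  rw [← ENNReal.ofReal_tsum_of_nonneg (fun k => mul_nonneg (ha k) (by positivity)) hre.summable,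
    hre.tsum_eq]

end HilbertSchmidtTrace

theorem theorem5 {H : Type u} {K : Type v}
    [NormedAddCommGroup H] [InnerProductSpace ℂ H] [CompleteSpace H]
    [NormedAddCommGroup K] [InnerProductSpace ℂ K] [CompleteSpace K]
    (A B : H →L[ℂ] K)
    (hA : HilbertSchmidtTrace.IsHilbertSchmidt A) (hB : HilbertSchmidtTrace.IsHilbertSchmidt B) :
    -- the three traces exist
    (∃ t : ℂ, HilbertSchmidtTrace.HasTrace (A.adjoint ∘L B) t) ∧
    (∃ p : ℂ, HilbertSchmidtTrace.HasTrace
      (HilbertSchmidtTrace.absOp A ∘L HilbertSchmidtTrace.absOp B) p) ∧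
    (∃ q : ℂ, HilbertSchmidtTrace.HasTrace
      (HilbertSchmidtTrace.absOp A.adjoint ∘L HilbertSchmidtTrace.absOp B.adjoint) q) ∧
    -- the two on the right-hand side are real and non-negative
    (HilbertSchmidtTrace.trace
      (HilbertSchmidtTrace.absOp A ∘L HilbertSchmidtTrace.absOp B)).im = 0 ∧
    0 ≤ (HilbertSchmidtTrace.trace
      (HilbertSchmidtTrace.absOp A ∘L HilbertSchmidtTrace.absOp B)).re ∧
    (HilbertSchmidtTrace.trace
      (HilbertSchmidtTrace.absOp A.adjoint ∘L HilbertSchmidtTrace.absOp B.adjoint)).im = 0 ∧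
    0 ≤ (HilbertSchmidtTrace.trace
      (HilbertSchmidtTrace.absOp A.adjoint ∘L HilbertSchmidtTrace.absOp B.adjoint)).re ∧
    -- the inequality
    ‖HilbertSchmidtTrace.trace (A.adjoint ∘L B)‖ ≤
      (HilbertSchmidtTrace.trace
        (HilbertSchmidtTrace.absOp A ∘L HilbertSchmidtTrace.absOp B)).re ^ (1 / 2 : ℝ) *
      (HilbertSchmidtTrace.trace
        (HilbertSchmidtTrace.absOp A.adjoint ∘L
          HilbertSchmidtTrace.absOp B.adjoint)).re ^ (1 / 2 : ℝ) := by
  open HilbertSchmidtTrace in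
  obtain ⟨t, ht⟩ := hA.exists_hasTrace hB
  obtain ⟨p, hp⟩ := hA.absOp.exists_hasTrace hB.absOp
  obtain ⟨q, hq⟩ := hA.adjoint.absOp.exists_hasTrace hB.adjoint.absOp
  rw [adjoint_eq_of_nonneg (absOp_nonneg _)] at hp hq
  obtain ⟨S, W, hS0, hSS, hWS, -, hWW⟩ := exists_factorization A
  obtain ⟨R, Z, hR0, hRR, hZR, -, hZZ⟩ := exists_factorization B
  obtain ⟨ι, e, b, hb, he⟩ := exists_eigenbasis hB.absOp.isCompactOperator (absOp_nonneg B)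
  have hRe (i : ι) : R (e i) = ((√(b i) : ℝ) : ℂ) • e i := by
    refine apply_eq_smul_of_sq_apply hR0 (Real.sqrt_nonneg _) ?_
    rw [Real.sq_sqrt (hb i), ← he, ← hRR]
    rfl
  obtain ⟨hp0, hpS⟩ := hasSum_norm_sq_comp_of_hasTrace hA.absOp S R
    (by rw [adjoint_eq_of_nonneg hS0]; exact hSS) (by rw [adjoint_eq_of_nonneg hR0]; exact hRR) hp e
  obtain ⟨hq0, hqS⟩ := hasSum_norm_sq_comp_of_hasTrace hA.adjoint.absOp W.adjoint Z
    (by rw [ContinuousLinearMap.adjoint_adjoint]; exact hWW) hZZ hq e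
  refine ⟨⟨t, ht⟩, ⟨p, hp⟩, ⟨q, hq⟩, ?_⟩
  rw [ht.trace_eq, hp.trace_eq, hq.trace_eq, ← Real.sqrt_eq_rpow, ← Real.sqrt_eq_rpow]
  refine ⟨hp0, hpS.nonneg fun _ => by positivity, hq0, hqS.nonneg fun _ => by positivity,
    norm_sum_le_of_hasSum ?_ hpS hqS⟩
  convert! ht ι e using 1
  funext i
  symm
  -- Both sides are `√(b i) * ⟪S (e i), W⋆ Z (e i)⟫`.
  rw [ContinuousLinearMap.comp_apply, ContinuousLinearMap.adjoint_inner_right, ← hWS, ← hZR,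
    ContinuousLinearMap.comp_apply, ContinuousLinearMap.comp_apply,
    ContinuousLinearMap.adjoint_inner_right, hRe, map_smul, map_smul, map_smul, inner_smul_left,
    inner_smul_right, Complex.conj_ofReal]
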